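/- Let $H$ be a finite-dimensional complex Hilbert space, let $\rho,\sigma$ be positive semi-definite operators on $H$ with $\rho\ll\sigma$, i.e. $\ker\sigma\subseteq\ker\rho$, and let $\alpha\in(1,2)$. Negative powers of $\sigma$ are taken on its support. For $\beta>-1$ and $m\ge 1$, an $m$-point Gauss–Radau–Jacobi quadrature with endpoint $0$ for the weight $t^{\beta}$ on $[0,1]$ consists of distinct real nodes $t_1=0,t_2,\dots,t_m$ and real weights $w_1,\dots,w_m$ such that $\sum_{i=1}^m w_i\,p(t_i)=\int_0^1 p(t)\,t^{\beta}\,dt$ for every real polynomial $p$ of degree at most $2m-2$. For every $m\ge 1$ there are such quadratures $(t_i,w_i)_{i=1}^m$ for the weight $t^{\alpha-2}$ and $(t_i',w_i')_{i=1}^m$ for the weight $t^{1-\alpha}$. For any such quadratures, all nodes $t_i,t_i'$ lie in $[0,1)$, all weights $w_i,w_i'$ are positive, and $$ \begin{aligned} \operatorname{Tr}[\rho^{\alpha}\sigma^{1-\alpha}]\ \le\ B_m := C_m &+\frac{\sin(\alpha\pi)}{\pi}\sum_{i=2}^m w_i\inf_Z\Big(\operatorname{Tr}[\rho Z^\dagger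 Z]+\operatorname{Tr}\big[\sigma\, t_i(\mathbb 1+Z)(\mathbb 1+Z^\dagger)\big]\Big)\\ &+\frac{\sin(\alpha\pi)}{\pi}\,w_1'\inf_{Z}\Big(\operatorname{Tr}[\rho(Z^\dagger+Z)]+\operatorname{Tr}[\sigma ZZ^\dagger]\Big)\\ &+\frac{\sin(\alpha\pi)}{\pi}\sum_{i=2}^m\frac{w_i'}{t_i'}\inf_{Z}\Big(\operatorname{Tr}[\rho(\mathbb 1+Z^\dagger)(\mathbb 1+Z)]+\frac1{t_i'}\operatorname{Tr}[\sigma ZZ^\dagger]\Big), \end{aligned} $$ where the infima run over all linear operators $Z$ on $H$ and are finite, and $$C_m=\frac{\sin((\alpha-1)\pi)}{\pi}\operatorname{Tr}[\rho]\Big(\frac1{\alpha-1}+\sum_{i=2}^m\frac{w_i'}{t_i'}\Big).$$ Moreover, $B_m\to\operatorname{Tr}[\rho^{\alpha}\sigma^{1-\alpha}]$ as $m\to\infty$. -/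

import Mathlib

open Filter Topology

namespace PetzRenyi

/-- `IsGaussRadauJacobi β m t w`: the numbers `t 1, …, t m` and `w 1, …, w m` are the nodes and the
weights of an `m`-point Gauss–Radau–Jacobi quadrature with endpoint node `0` for the weight function
`x ^ β` on `[0, 1]`: the `m ≥ 1` nodes are distinct, the first one is `0`, and the rule integrates
every polynomial of degree at most `2 * m - 2` exactly.  (Values of `t` and `w` at indices outside
`{1, …, m}` play no role.) -/
structure IsGaussRadauJacobi (β : ℝ) (m : ℕ) (t w : ℕ → ℝ) : Prop where
  one_le : 1 ≤ m
  endpoint : t 1 = 0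
  distinct : Set.InjOn t (Set.Icc 1 m)
  exact_quadrature : ∀ p : Polynomial ℝ, p.natDegree ≤ 2 * m - 2 →
    ∑ i ∈ Finset.Icc 1 m, w i * p.eval (t i) = ∫ x in (0 : ℝ)..1, p.eval x * x ^ β

section Operators

variable {H : Type*} [NormedAddCommGroup H] [InnerProductSpace ℂ H]

/-- The trace of an operator on a finite-dimensional space, as a real number.  It is only used for
products of two self-adjoint operators, whose trace is real. -/
noncomputable def tr (A : H →L[ℂ] H) : ℝ :=
  (LinearMap.trace ℂ H (A : H →ₗ[ℂ] H)).re

/-- `ρ ≪ σ`, that is, `ker σ ⊆ ker ρ`. -/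
def Dominated (ρ σ : H →L[ℂ] H) : Prop :=
  LinearMap.ker (σ : H →ₗ[ℂ] H) ≤ LinearMap.ker (ρ : H →ₗ[ℂ] H)

variable [CompleteSpace H]

/-- `Tr[ρ ^ α σ ^ (1 - α)]`.  The powers are those of the continuous functional calculus on positive
operators; since `0 ^ s = 0` for `s ≠ 0`, negative powers are taken on the support (powers of the
pseudo-inverse). -/
noncomputable def petzTrace (ρ σ : H →L[ℂ] H) (α : ℝ) : ℝ :=
  tr (ρ ^ α * σ ^ (1 - α))

/-- `Tr[ρ Z† Z] + Tr[σ (s (1 + Z) (1 + Z†))]`. -/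
noncomputable def objFirst (ρ σ : H →L[ℂ] H) (s : ℝ) (Z : H →L[ℂ] H) : ℝ :=
  tr (ρ * (star Z * Z)) + tr (σ * ((s : ℂ) • ((1 + Z) * (1 + star Z))))

/-- `Tr[ρ (Z† + Z)] + Tr[σ Z Z†]`. -/
noncomputable def objEnd (ρ σ : H →L[ℂ] H) (Z : H →L[ℂ] H) : ℝ :=
  tr (ρ * (star Z + Z)) + tr (σ * (Z * star Z))

/-- `Tr[ρ (1 + Z†) (1 + Z)] + (1 / s) Tr[σ Z Z†]`. -/
noncomputable def objSecond (ρ σ : H →L[ℂ] H) (s : ℝ) (Z : H →L[ℂ] H) : ℝ :=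
  tr (ρ * ((1 + star Z) * (1 + Z))) + 1 / s * tr (σ * (Z * star Z))

/-- The constant `C_m`. -/
noncomputable def constTerm (ρ : H →L[ℂ] H) (α : ℝ) (m : ℕ) (t' w' : ℕ → ℝ) : ℝ :=
  Real.sin ((α - 1) * Real.pi) / Real.pi * tr ρ *
    (1 / (α - 1) + ∑ i ∈ Finset.Icc 2 m, w' i / t' i)

/-- The variational upper bound built from the nodes and weights `(t, w)` and `(t', w')`; each
infimum is over all operators on `H`. -/
noncomputable def upperBound (ρ σ : H →L[ℂ] H) (α : ℝ) (m : ℕ) (t w t' w' : ℕ → ℝ) : ℝ :=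
  constTerm ρ α m t' w'
    + Real.sin (α * Real.pi) / Real.pi *
        (∑ i ∈ Finset.Icc 2 m, w i * (⨅ Z : H →L[ℂ] H, objFirst ρ σ (t i) Z))
    + Real.sin (α * Real.pi) / Real.pi * w' 1 * (⨅ Z : H →L[ℂ] H, objEnd ρ σ Z)
    + Real.sin (α * Real.pi) / Real.pi *
        (∑ i ∈ Finset.Icc 2 m, w' i / t' i * (⨅ Z : H →L[ℂ] H, objSecond ρ σ (t' i) Z))

end Operators

end PetzRenyi

/-! Take eigenbases `e` of `ρ` and `f` of `σ`, with eigenvalues `l j` and `s k`. Each objective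
splits into a sum over the entries ⟨f k, Z (e j)⟩, which can be chosen independently, so each
infimum is found by completing squares. Both sides become sums over (j, k) weighted by |⟨f k, e j⟩|²
(`petzTrace_eq_sum`, `upperBound_eq_sum`), and the claim reduces to positive scalars l, k: compare
l^α k^(1-α) with `scalarBound`.

There, y = l/k has y^(α-1) proportional to ∫₀^∞ t^(α-2) y/(t+y) dt. Splitting at 1 and inverting the
tail gives integrals over [0, 1] of 1/(x+a) against x^(α-2) and x^(1-α)
(`rpow_mul_rpow_eq_integral`). The bound replaces each by its quadrature. Radau rules with node 0
overestimate 1/(x+a) (`integral_le_sum_inv`), and they converge on continuous functions by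
Weierstrass approximation and positivity of the weights (`tendsto_quadrature`).

The rules exist because 0 together with the zeros of the orthogonal polynomial for x^(β+1) serve as
nodes. -/

namespace PetzRenyi

/-! ### Gauss–Radau–Jacobi quadrature: existence, positivity, one-sided error, convergence. -/

section Quadrature

open Polynomial MeasureTheory Set

theorem intervalIntegrable_mul_rpow {β : ℝ} (hβ : -1 < β) {f : ℝ → ℝ}
    (hf : ContinuousOn f (Icc 0 1)) :
    IntervalIntegrable (fun x => f x * x ^ β) volume 0 1 :=
  (intervalIntegral.intervalIntegrable_rpow' hβ).continuousOn_mul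
    (by rwa [uIcc_of_le zero_le_one])

/-- The functional `p ↦ ∫ p(x) x ^ β dx` on polynomials. -/
noncomputable def jacobiFunctional (β : ℝ) (hβ : -1 < β) : ℝ[X] →ₗ[ℝ] ℝ where
  toFun p := ∫ x in (0 : ℝ)..1, p.eval x * x ^ β
  map_add' p q := by
    simp only [eval_add, add_mul]
    exact intervalIntegral.integral_add (intervalIntegrable_mul_rpow hβ p.continuousOn)
      (intervalIntegrable_mul_rpow hβ q.continuousOn)
  map_smul' c p := by
    simp only [eval_smul, smul_eq_mul, mul_assoc, RingHom.id_apply]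
    exact intervalIntegral.integral_const_mul _ _

/-- A functional on polynomials is positive on `[0, 1]` if it is positive on the nonzero polynomials
that are nonnegative on `[0, 1]`. -/
def PositiveOnUnit (Λ : ℝ[X] →ₗ[ℝ] ℝ) : Prop :=
  ∀ p : ℝ[X], p ≠ 0 → (∀ x ∈ Icc (0 : ℝ) 1, 0 ≤ p.eval x) → 0 < Λ p

theorem positiveOnUnit_jacobiFunctional (β : ℝ) (hβ : -1 < β) :
    PositiveOnUnit (jacobiFunctional β hβ) := by
  intro p hp h
  change 0 < ∫ x in (0 : ℝ)..1, p.eval x * x ^ β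
  rw [intervalIntegral.integral_pos_iff_support_of_nonneg_ae' _
    (intervalIntegrable_mul_rpow hβ p.continuousOn)]
  · refine ⟨zero_lt_one, ?_⟩
    have h1 : Ioc (0 : ℝ) 1 \ (p.roots.toFinset : Set ℝ) ⊆
        Function.support (fun x => p.eval x * x ^ β) ∩ Ioc 0 1 := by
      rintro x ⟨hx, hx'⟩
      refine ⟨mul_ne_zero (fun h0 => hx' ?_) (Real.rpow_pos_of_pos hx.1 β).ne', hx⟩
      simpa [hp] using h0
    refine lt_of_lt_of_le ?_ (measure_mono h1)
    rw [measure_sdiff_null (Set.Finite.measure_zero (Finset.finite_toSet _) _)]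
    simp
  · rw [uIoc_of_le zero_le_one]
    refine (ae_restrict_iff' measurableSet_Ioc).2 (ae_of_all _ fun x hx => ?_)
    exact mul_nonneg (h x ⟨hx.1.le, hx.2⟩) (Real.rpow_nonneg hx.1.le β)

/-- The form (u, v) ↦ Λ(uv) is definite in degree < n, hence nondegenerate, so some u represents v ↦
Λ(Xⁿ v); then Xⁿ - u is orthogonal. -/
theorem exists_monic_orthogonal {Λ : ℝ[X] →ₗ[ℝ] ℝ} (hΛ : PositiveOnUnit Λ) (n : ℕ) :
    ∃ q : ℝ[X], q.Monic ∧ q.natDegree = n ∧ ∀ u : ℝ[X], u.degree < n → Λ (q * u) = 0 := by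
  let B : degreeLT ℝ n →ₗ[ℝ] Module.Dual ℝ (degreeLT ℝ n) :=
    LinearMap.mk₂ ℝ (fun u v => Λ ((u : ℝ[X]) * v)) (by intros; simp [add_mul])
      (by intros; simp) (by intros; simp [mul_add]) (by intros; simp)
  have hB : Function.Injective B := by
    refine (injective_iff_map_eq_zero B).2 fun u hu => ?_
    by_contra hne
    have h1 : B u u = 0 := by rw [hu]; rfl
    have h2 : 0 < Λ ((u : ℝ[X]) * u) := hΛ _ (by simpa using hne)
      (fun x _ => by rw [eval_mul]; exact mul_self_nonneg _)
    exact h2.ne' h1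
  have hB' : Function.Surjective B :=
    (LinearMap.injective_iff_surjective_of_finrank_eq_finrank
      (Subspace.dual_finrank_eq).symm).1 hB
  obtain ⟨u, hu⟩ := hB' ((Λ ∘ₗ LinearMap.mulLeft ℝ (X ^ n)) ∘ₗ (degreeLT ℝ n).subtype)
  have hdu : (u : ℝ[X]).degree < n := mem_degreeLT.1 u.2
  refine ⟨X ^ n - (u : ℝ[X]), monic_X_pow_sub hdu, natDegree_eq_of_degree_eq_some ?_,
    fun v hv => ?_⟩
  · rw [degree_sub_eq_left_of_degree_lt (by rwa [degree_X_pow]), degree_X_pow]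
  · have := LinearMap.congr_fun hu ⟨v, mem_degreeLT.2 hv⟩
    have h' : Λ ((u : ℝ[X]) * v) = Λ (X ^ n * v) := this
    rw [sub_mul, map_sub, h', sub_self]

/-- An orthogonal polynomial has no nonconstant factor that is nonnegative on `[0, 1]`. -/
theorem not_dvd_of_orthogonal {Λ : ℝ[X] →ₗ[ℝ] ℝ} (hΛ : PositiveOnUnit Λ) {q s : ℝ[X]}
    (hq : q.Monic) (horth : ∀ u : ℝ[X], u.degree < q.natDegree → Λ (q * u) = 0)
    (hs : 0 < s.natDegree) (hpos : ∀ x ∈ Icc (0 : ℝ) 1, 0 ≤ s.eval x) : ¬ s ∣ q := by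
  rintro ⟨r, hr⟩
  have hs0 : s ≠ 0 := by rintro rfl; simp at hs
  have hr0 : r ≠ 0 := by rintro rfl; exact hq.ne_zero (by simpa using hr)
  -- The cofactor `r` has smaller degree, so Λ(qr) = 0; yet qr = s r² is nonnegative on [0, 1].
  have h1 := horth r (by
    rw [degree_eq_natDegree hr0, hr, natDegree_mul hs0 hr0]; exact_mod_cast by omega)
  have h2 := hΛ (q * r) (mul_ne_zero hq.ne_zero hr0) (fun x hx => by
    rw [hr, eval_mul, eval_mul, mul_assoc]
    exact mul_nonneg (hpos x hx) (mul_self_nonneg _))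
  exact h2.ne' h1

/-- A nonreal zero z would give the factor (x - Re z)² + (Im z)², which is nonnegative. -/
theorem splits_of_orthogonal {Λ : ℝ[X] →ₗ[ℝ] ℝ} (hΛ : PositiveOnUnit Λ) {q : ℝ[X]}
    (hq : q.Monic) (horth : ∀ u : ℝ[X], u.degree < q.natDegree → Λ (q * u) = 0) :
    q.Splits := by
  obtain ⟨c, hc⟩ := UniqueFactorizationMonoid.factors_prod hq.ne_zero
  rw [← hc]
  refine (Splits.multisetProd fun g hg' => Splits.of_degree_eq_one ?_).mul c.isUnit.splits
  have hg := UniqueFactorizationMonoid.irreducible_of_factor g hg'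
  have hgq := UniqueFactorizationMonoid.dvd_of_mem_factors hg'
  obtain ⟨z, hz⟩ := IsAlgClosed.exists_aeval_eq_zero ℂ g (degree_pos_of_irreducible hg).ne'
  by_cases him : z.im = 0
  · have hroot : g.IsRoot z.re := by
      have h1 : (z.re : ℂ) = z := Complex.ext (by simp) (by simp [him])
      rw [← h1] at hz
      have h2 : aeval ((algebraMap ℝ ℂ) z.re) g = 0 := hz
      rw [aeval_algebraMap_apply] at h2
      simpa using h2
    exact degree_eq_one_of_irreducible_of_root hg hroot
  · exfalso
    have hd := (g.quadratic_dvd_of_aeval_eq_zero_im_ne_zero hz him).trans hgq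
    have hnd : (X ^ 2 - C (2 * z.re) * X + C (‖z‖ ^ 2) : ℝ[X]).natDegree = 2 := by compute_degree!
    refine not_dvd_of_orthogonal hΛ hq horth (by rw [hnd]; norm_num) (fun x _ => ?_) hd
    have h3 : ‖z‖ ^ 2 = z.re ^ 2 + z.im ^ 2 := by
      rw [Complex.sq_norm, Complex.normSq_apply]; ring
    simp only [eval_add, eval_sub, eval_pow, eval_X, eval_mul, eval_C, h3]
    nlinarith [sq_nonneg (x - z.re), sq_nonneg z.im]

theorem nodup_roots_of_orthogonal {Λ : ℝ[X] →ₗ[ℝ] ℝ} (hΛ : PositiveOnUnit Λ) {q : ℝ[X]}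
    (hq : q.Monic) (horth : ∀ u : ℝ[X], u.degree < q.natDegree → Λ (q * u) = 0) :
    q.roots.Nodup := by
  rw [Multiset.nodup_iff_count_le_one]
  intro a
  rw [count_roots]
  by_contra! h
  have hd : (X - C a) ^ 2 ∣ q := (le_rootMultiplicity_iff hq.ne_zero).1 h
  refine not_dvd_of_orthogonal hΛ hq horth (by simp) (fun x _ => ?_) hd
  rw [eval_pow]; exact sq_nonneg _

/-- The nodes are the zeros of X q, where q is orthogonal for x^(β+1), the extra power absorbing the
factor X; the weights are interpolatory. Dividing p by X q leaves a remainder that interpolation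
integrates exactly and a quotient orthogonal to q. -/
theorem exists_isGaussRadauJacobi {β : ℝ} (hβ : -1 < β) {m : ℕ} (hm : 1 ≤ m) :
    ∃ t w : ℕ → ℝ, IsGaussRadauJacobi β m t w := by
  obtain ⟨n, rfl⟩ : ∃ n, m = n + 1 := ⟨m - 1, by omega⟩
  have hβ' : -1 < β + 1 := by linarith
  have hΛ := positiveOnUnit_jacobiFunctional (β + 1) hβ'
  obtain ⟨q, hq, hdeg, horth⟩ := exists_monic_orthogonal hΛ n
  have horth' := horth
  rw [← hdeg] at horth'
  have hsplit := splits_of_orthogonal hΛ hq horth'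
  have hnodup := nodup_roots_of_orthogonal hΛ hq horth'
  have hcard : q.roots.toFinset.card = n := by
    rw [Multiset.toFinset_card_of_nodup hnodup, splits_iff_card_roots.1 hsplit, hdeg]
  have h0 : (0 : ℝ) ∉ q.roots.toFinset := by
    intro h
    have hr : X ∣ q := by
      rw [Multiset.mem_toFinset, mem_roots hq.ne_zero] at h
      simpa using dvd_iff_isRoot.2 h
    exact not_dvd_of_orthogonal hΛ hq horth' (by simp) (fun x hx => by simpa using hx.1) hr
  let e := q.roots.toFinset.equivFinOfCardEq hcard
  -- Indices 2, …, n + 1 enumerate the roots of `q`; the default value 0 supplies the endpoint node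
  -- at index 1.
  let t : ℕ → ℝ := fun i => if h : 2 ≤ i ∧ i ≤ n + 1 then
    (e.symm ⟨i - 2, by omega⟩ : ℝ) else 0
  have ht1 : t 1 = 0 := by simp [t]
  have htroot : ∀ i, 2 ≤ i → i ≤ n + 1 → t i ∈ q.roots.toFinset := fun i h h' => by
    simp [t, h, h', -Multiset.mem_toFinset]
  have hinj : InjOn t (Icc 1 (n + 1)) := by
    intro i hi j hj hij
    have hcase : ∀ i ∈ Icc 1 (n + 1), i = 1 ∨ 2 ≤ i := fun i hi => by
      have := hi.1; omega
    rcases hcase i hi with rfl | hi2 <;> rcases hcase j hj with rfl | hj2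
    · rfl
    · exact absurd (htroot j hj2 hj.2) (by rw [← hij, ht1]; exact h0)
    · exact absurd (htroot i hi2 hi.2) (by rw [hij, ht1]; exact h0)
    · have h1 := hi.2
      have h2 := hj.2
      simp only [t, hi2, hj2, h1, h2, and_self, dite_true] at hij
      have := Fin.mk.inj_iff.1 (e.symm.injective (Subtype.ext hij))
      omega
  let S := Finset.Icc 1 (n + 1)
  have hinjS : InjOn t (S : Set ℕ) := by simpa [S] using hinj
  let w : ℕ → ℝ := fun i => jacobiFunctional β hβ (Lagrange.basis S t i)
  refine ⟨t, w, hm, ht1, hinj, fun p hp => ?_⟩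
  have hN : (X * q).Monic := monic_X.mul hq
  have hNdeg : (X * q).natDegree = n + 1 := by
    rw [natDegree_mul X_ne_zero hq.ne_zero, natDegree_X, hdeg]; omega
  have hNt : ∀ i ∈ S, (X * q).eval (t i) = 0 := by
    intro i hi
    have hi := Finset.mem_Icc.1 hi
    rw [eval_mul, eval_X]
    rcases (show i = 1 ∨ 2 ≤ i by omega) with rfl | h2
    · rw [ht1, zero_mul]
    · have := htroot i h2 hi.2
      rw [Multiset.mem_toFinset, mem_roots hq.ne_zero] at this
      rw [this.eq_zero, mul_zero]
  set u := p /ₘ (X * q) with hu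
  set v := p %ₘ (X * q) with hv
  have hpuv : v + (X * q) * u = p := modByMonic_add_div p (X * q)
  have hvdeg : v.degree < S.card := by
    have := degree_modByMonic_lt p hN
    rw [degree_eq_natDegree hN.ne_zero, hNdeg] at this
    rwa [show S.card = n + 1 by simp [S]]
  have hudeg : (X * q) * u ≠ 0 → u.degree < n := by
    intro h
    have hu0 : u ≠ 0 := right_ne_zero_of_mul h
    have h1 : ¬ p.degree < (X * q).degree := fun h1 =>
      hu0 ((divByMonic_eq_zero_iff hN).2 h1)
    have h2 := natDegree_le_natDegree (not_lt.1 h1)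
    have h3 : u.natDegree = _ := natDegree_divByMonic p hN
    rw [hNdeg] at h2 h3
    rw [degree_eq_natDegree hu0]
    exact_mod_cast (show u.natDegree < n by omega)
  have hzero : jacobiFunctional β hβ ((X * q) * u) = 0 := by
    by_cases h : (X * q) * u = 0
    · rw [h, map_zero]
    · rw [← horth u (hudeg h)]
      refine intervalIntegral.integral_congr_ae (ae_of_all _ fun x hx => ?_)
      rw [uIoc_of_le zero_le_one] at hx
      simp only [eval_mul, eval_X]
      rw [Real.rpow_add_one hx.1.ne']
      ring
  have hvL : v = Lagrange.interpolate S t fun i => p.eval (t i) := by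
    refine Lagrange.eq_interpolate_of_eval_eq _ hinjS hvdeg fun i hi => ?_
    rw [← hpuv, eval_add, eval_mul (p := X * q), hNt i hi, zero_mul, add_zero]
  have hpv : jacobiFunctional β hβ p = jacobiFunctional β hβ v := by
    rw [← hpuv, map_add, hzero, add_zero]
  change _ = jacobiFunctional β hβ p
  rw [hpv, hvL, Lagrange.interpolate_apply, map_sum]
  refine Finset.sum_congr rfl fun i _ => ?_
  rw [← smul_eq_C_mul, map_smul, smul_eq_mul, mul_comm]

variable {β : ℝ} {m : ℕ} {t w : ℕ → ℝ}

/-- The value of the weight times a polynomial that vanishes at all other nodes. -/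
theorem IsGaussRadauJacobi.weight_mul_eval (h : IsGaussRadauJacobi β m t w) (hβ : -1 < β) {p : ℝ[X]}
    (hp : p.natDegree ≤ 2 * m - 2) {i : ℕ} (hi : i ∈ Finset.Icc 1 m)
    (hpz : ∀ j ∈ Finset.Icc 1 m, j ≠ i → p.eval (t j) = 0) :
    w i * p.eval (t i) = jacobiFunctional β hβ p := by
  refine Eq.trans ?_ (h.exact_quadrature p hp)
  rw [Finset.sum_eq_single_of_mem i hi fun j hj hji => by rw [hpz j hj hji, mul_zero]]

/-- Test the rule on the square of the nodal polynomial with node i removed; its degree is exactly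
2m - 2. -/
theorem IsGaussRadauJacobi.weight_pos (h : IsGaussRadauJacobi β m t w) (hβ : -1 < β) {i : ℕ}
    (hi : i ∈ Finset.Icc 1 m) : 0 < w i := by
  have hm := h.one_le
  let r : ℝ[X] := ∏ j ∈ (Finset.Icc 1 m).erase i, (X - C (t j))
  have hr : r.natDegree = m - 1 := by
    simp [r, natDegree_prod_of_monic _ _ fun j _ => monic_X_sub_C (t j), hi]
  have hr0 : r ≠ 0 := (monic_prod_of_monic _ _ fun j _ => monic_X_sub_C (t j)).ne_zero
  have h1 := h.weight_mul_eval hβ (p := r ^ 2) (by rw [natDegree_pow, hr]; omega) hi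
    (fun j hj hji => by
      simp only [r, eval_pow, eval_prod]
      rw [Finset.prod_eq_zero (Finset.mem_erase.2 ⟨hji, hj⟩) (by simp)]; simp)
  have h2 : 0 < jacobiFunctional β hβ (r ^ 2) :=
    positiveOnUnit_jacobiFunctional β hβ _ (pow_ne_zero _ hr0)
      (fun x _ => by rw [eval_pow]; exact sq_nonneg _)
  rw [← h1, eval_pow] at h2
  exact pos_of_mul_pos_left h2 (sq_nonneg _)

theorem IsGaussRadauJacobi.node_mem_Ioo (h : IsGaussRadauJacobi β m t w) (hβ : -1 < β) {i : ℕ}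
    (hi : i ∈ Finset.Icc 2 m) : t i ∈ Ioo (0 : ℝ) 1 := by
  have hi' := Finset.mem_Icc.1 hi
  have hi1 : i ∈ Finset.Icc 1 m := Finset.mem_Icc.2 ⟨by omega, hi'.2⟩
  let r : ℝ[X] := ∏ j ∈ (Finset.Icc 2 m).erase i, (X - C (t j))
  have hr : r.natDegree = m - 2 := by
    simp [r, natDegree_prod_of_monic _ _ fun j _ => monic_X_sub_C (t j), hi]; omega
  have hr0 : r ≠ 0 := (monic_prod_of_monic _ _ fun j _ => monic_X_sub_C (t j)).ne_zero
  -- `X * s * r ^ 2` vanishes at every node but `t i` and has degree at most 2m - 2. Taking s = 1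
  -- and s = 1 - X gives the two bounds.
  have key : ∀ s : ℝ[X], s ≠ 0 → s.natDegree ≤ 1 → (∀ x ∈ Icc (0 : ℝ) 1, 0 ≤ s.eval x) →
      0 < t i * s.eval (t i) := by
    intro s hs0 hs hspos
    have h1 := h.weight_mul_eval hβ (p := X * s * r ^ 2) (by
        rw [natDegree_mul (mul_ne_zero X_ne_zero hs0) (pow_ne_zero _ hr0),
          natDegree_mul X_ne_zero hs0, natDegree_pow, hr, natDegree_X]
        omega) hi1 (fun j hj hji => by
      have hj := Finset.mem_Icc.1 hj
      simp only [r, eval_mul, eval_X, eval_pow, eval_prod]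
      rcases (show j = 1 ∨ 2 ≤ j by omega) with rfl | h2
      · simp [h.endpoint]
      · rw [Finset.prod_eq_zero (Finset.mem_erase.2 ⟨hji, Finset.mem_Icc.2 ⟨h2, hj.2⟩⟩) (by simp)]
        simp)
    have h2 : 0 < jacobiFunctional β hβ (X * s * r ^ 2) :=
      positiveOnUnit_jacobiFunctional β hβ _
        (mul_ne_zero (mul_ne_zero X_ne_zero hs0) (pow_ne_zero _ hr0)) (fun x hx => by
          simp only [eval_mul, eval_X, eval_pow]
          exact mul_nonneg (mul_nonneg hx.1 (hspos x hx)) (sq_nonneg _))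
    rw [← h1] at h2
    simp only [eval_mul, eval_X, eval_pow] at h2
    exact pos_of_mul_pos_left (pos_of_mul_pos_right h2 (h.weight_pos hβ hi1).le) (sq_nonneg _)
  have h1 : 0 < t i := by simpa using key 1 one_ne_zero (by simp) (by simp)
  have h2 := key (1 - X) (fun h0 => by simpa using congrArg (eval 0) h0)
    (by compute_degree) (fun x hx => by simpa using hx.2)
  refine ⟨h1, ?_⟩
  have := pos_of_mul_pos_right h2 h1.le
  simpa using this

theorem IsGaussRadauJacobi.node_mem_Ico (h : IsGaussRadauJacobi β m t w) (hβ : -1 < β) {i : ℕ}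
    (hi : i ∈ Finset.Icc 1 m) : t i ∈ Ico (0 : ℝ) 1 := by
  have hi' := Finset.mem_Icc.1 hi
  rcases (show i = 1 ∨ 2 ≤ i by omega) with rfl | h2
  · rw [h.endpoint]; simp
  · exact Ioo_subset_Ico_self (h.node_mem_Ioo hβ (Finset.mem_Icc.2 ⟨h2, hi'.2⟩))

/-- The quadrature overestimates the integral of `x ↦ 1 / (x + a)`. -/
theorem IsGaussRadauJacobi.integral_le_sum_inv (h : IsGaussRadauJacobi β m t w) (hβ : -1 < β)
    {a : ℝ} (ha : 0 < a) :
    ∫ x in (0 : ℝ)..1, (x + a)⁻¹ * x ^ β ≤ ∑ i ∈ Finset.Icc 1 m, w i * (t i + a)⁻¹ := by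
  have hm := h.one_le
  let r : ℝ[X] := ∏ j ∈ Finset.Icc 2 m, (X - C (t j))
  have hrm : r.Monic := monic_prod_of_monic _ _ fun j _ => monic_X_sub_C (t j)
  have hr : r.natDegree = m - 1 := by
    simp [r, natDegree_prod_of_monic _ _ fun j _ => monic_X_sub_C (t j)]
  let q : ℝ[X] := X * r ^ 2
  have hra : r.eval (-a) ≠ 0 := by
    simp only [r, eval_prod, Finset.prod_ne_zero_iff]
    intro j hj
    have := (h.node_mem_Ioo hβ hj).1
    simp only [eval_sub, eval_X, eval_C]
    linarith
  have hqa : q.eval (-a) < 0 := by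
    simp only [q, eval_mul, eval_X, eval_pow]
    have := sq_pos_of_ne_zero hra
    nlinarith
  set c := q.eval (-a) with hc
  -- p = (1 - q/q(-a))/(x + a) agrees with 1/(x + a) at the nodes and has degree at most 2m - 2.
  -- Since q(-a) < 0 ≤ q on [0, 1], it lies above 1/(x + a) there.
  obtain ⟨p, hp⟩ : X - C (-a) ∣ 1 - C c⁻¹ * q := dvd_iff_isRoot.2 (by
    simp [IsRoot.def, ← hc, hqa.ne])
  have hpe : ∀ x, 0 ≤ x → p.eval x = (x + a)⁻¹ - c⁻¹ * q.eval x * (x + a)⁻¹ := by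
    intro x hx
    have h1 := congrArg (eval x) hp
    simp only [eval_sub, eval_one, eval_mul, eval_C, eval_X, sub_neg_eq_add] at h1
    have : x + a ≠ 0 := by positivity
    field_simp
    linear_combination -h1
  have hpdeg : p.natDegree ≤ 2 * m - 2 := by
    by_cases hp0 : p = 0
    · simp [hp0]
    have h1 : (1 - C c⁻¹ * q).natDegree ≤ 2 * m - 1 := by
      refine (natDegree_sub_le _ _).trans (max_le (by simp) ((natDegree_C_mul_le _ _).trans ?_))
      rw [natDegree_mul X_ne_zero (pow_ne_zero _ hrm.ne_zero), natDegree_X, natDegree_pow, hr]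
      omega
    rw [hp, natDegree_mul (X_sub_C_ne_zero _) hp0, natDegree_X_sub_C] at h1
    omega
  have hsum : ∑ i ∈ Finset.Icc 1 m, w i * (t i + a)⁻¹ =
      ∑ i ∈ Finset.Icc 1 m, w i * p.eval (t i) := by
    refine Finset.sum_congr rfl fun i hi => ?_
    rw [hpe _ (h.node_mem_Ico hβ hi).1]
    have hi' := Finset.mem_Icc.1 hi
    have : q.eval (t i) = 0 := by
      simp only [q, r, eval_mul, eval_X, eval_pow, eval_prod]
      rcases (show i = 1 ∨ 2 ≤ i by omega) with rfl | h2
      · simp [h.endpoint]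
      · rw [Finset.prod_eq_zero (Finset.mem_Icc.2 ⟨h2, hi'.2⟩) (by simp)]
        simp
    rw [this]; ring
  rw [hsum, h.exact_quadrature p hpdeg]
  refine intervalIntegral.integral_mono_on zero_le_one
    (intervalIntegrable_mul_rpow hβ (ContinuousOn.inv₀ (by fun_prop) fun x hx => ?_))
    (intervalIntegrable_mul_rpow hβ p.continuousOn) fun x hx => ?_
  · have := hx.1; positivity
  · refine mul_le_mul_of_nonneg_right ?_ (Real.rpow_nonneg hx.1 β)
    rw [hpe x hx.1]
    have h1 : 0 ≤ q.eval x := by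
      simp only [q, eval_mul, eval_X, eval_pow]
      exact mul_nonneg hx.1 (sq_nonneg _)
    have h2 : c⁻¹ ≤ 0 := inv_nonpos.2 hqa.le
    have h3 : 0 ≤ (x + a)⁻¹ := inv_nonneg.2 (by linarith [hx.1])
    have := mul_nonneg (mul_nonneg (neg_nonneg.2 h2) h1) h3
    linarith

/-- Gauss-Radau quadratures of a continuous function converge to its integral. -/
theorem tendsto_quadrature (hβ : -1 < β) {t w : ℕ → ℕ → ℝ}
    (h : ∀ m : ℕ, 1 ≤ m → IsGaussRadauJacobi β m (t m) (w m)) {f : ℝ → ℝ}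
    (hf : ContinuousOn f (Icc 0 1)) :
    Tendsto (fun m => ∑ i ∈ Finset.Icc 1 m, w m i * f (t m i)) atTop
      (𝓝 (∫ x in (0 : ℝ)..1, f x * x ^ β)) := by
  set W := jacobiFunctional β hβ 1 with hW
  have hW0 : 0 < W := positiveOnUnit_jacobiFunctional β hβ 1 one_ne_zero (by simp)
  have hWi : W = ∫ x in (0 : ℝ)..1, x ^ β := by simp [hW, jacobiFunctional]
  rw [Metric.tendsto_atTop]
  intro ε hε
  -- The weights are positive with sum `W`, the total mass, so replacing f by p costs at most ε/3 in
  -- both the quadrature and the integral.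
  obtain ⟨p, hp⟩ := exists_polynomial_near_of_continuousOn 0 1 f hf (ε / (3 * W)) (by positivity)
  refine ⟨p.natDegree + 1, fun m hm => ?_⟩
  have hq := h m (by omega)
  have hsumW : ∑ i ∈ Finset.Icc 1 m, w m i = W := by
    have := hq.exact_quadrature 1 (by simp)
    simpa [hWi] using this
  have h1 : |∑ i ∈ Finset.Icc 1 m, w m i * f (t m i) - jacobiFunctional β hβ p| ≤ ε / 3 := by
    have he : jacobiFunctional β hβ p = ∑ i ∈ Finset.Icc 1 m, w m i * p.eval (t m i) :=
      (hq.exact_quadrature p (by omega)).symm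
    rw [he, ← Finset.sum_sub_distrib]
    refine (Finset.abs_sum_le_sum_abs _ _).trans ?_
    calc _ ≤ ∑ i ∈ Finset.Icc 1 m, w m i * (ε / (3 * W)) := by
          refine Finset.sum_le_sum fun i hi => ?_
          rw [← mul_sub, abs_mul, abs_of_pos (hq.weight_pos hβ hi), abs_sub_comm]
          exact mul_le_mul_of_nonneg_left
            (hp _ (Ico_subset_Icc_self (hq.node_mem_Ico hβ hi))).le (hq.weight_pos hβ hi).le
      _ = ε / 3 := by rw [← Finset.sum_mul, hsumW]; field_simp
  have h2 : |jacobiFunctional β hβ p - ∫ x in (0 : ℝ)..1, f x * x ^ β| ≤ ε / 3 := by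
    change |(∫ x in (0 : ℝ)..1, p.eval x * x ^ β) - ∫ x in (0 : ℝ)..1, f x * x ^ β| ≤ ε / 3
    have hI := intervalIntegrable_mul_rpow hβ p.continuousOn
    have hI' := intervalIntegrable_mul_rpow hβ hf
    rw [← intervalIntegral.integral_sub hI hI']
    refine (intervalIntegral.abs_integral_le_integral_abs zero_le_one).trans ?_
    calc _ ≤ ∫ x in (0 : ℝ)..1, ε / (3 * W) * x ^ β := by
          refine intervalIntegral.integral_mono_on zero_le_one (hI.sub hI').abs
            ((intervalIntegral.intervalIntegrable_rpow' hβ).const_mul _) fun x hx => ?_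
          rw [← sub_mul, abs_mul, abs_of_nonneg (Real.rpow_nonneg hx.1 β)]
          exact mul_le_mul_of_nonneg_right (hp x hx).le (Real.rpow_nonneg hx.1 β)
      _ = ε / 3 := by rw [intervalIntegral.integral_const_mul, ← hWi]; field_simp
  rw [Real.dist_eq]
  have := abs_add_le (∑ i ∈ Finset.Icc 1 m, w m i * f (t m i) - jacobiFunctional β hβ p)
    (jacobiFunctional β hβ p - ∫ x in (0 : ℝ)..1, f x * x ^ β)
  rw [sub_add_sub_cancel] at this
  linarith

end Quadrature

/-! ### The scalar inequality and its limit. -/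

section Scalar

open MeasureTheory Set Real

/-- The substitution t = x/(1 - x) gives the Beta integral B(p, 1 - p), evaluated by Euler's
reflection formula. -/
theorem integral_Ioi_rpow_div_one_add {p : ℝ} (hp : p ∈ Ioo (0 : ℝ) 1) :
    ∫ t in Ioi (0 : ℝ), t ^ (p - 1) / (t + 1) = π / sin (p * π) := by
  have himg : (fun x : ℝ => x / (1 - x)) '' Ioo 0 1 = Ioi 0 := by
    ext y
    constructor
    · rintro ⟨x, hx, rfl⟩
      exact div_pos hx.1 (sub_pos.2 hx.2)
    · intro hy
      have hy : 0 < y := hy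
      refine ⟨y / (1 + y), ⟨by positivity, (div_lt_one (by positivity)).2 (by linarith)⟩, ?_⟩
      have : (1 + y) ≠ 0 := by positivity
      change y / (1 + y) / (1 - y / (1 + y)) = y
      field_simp
      ring
  have hderiv : ∀ x ∈ Ioo (0 : ℝ) 1,
      HasDerivWithinAt (fun x : ℝ => x / (1 - x)) (((1 - x) ^ 2)⁻¹) (Ioo 0 1) x := by
    intro x hx
    have h1 : 1 - x ≠ 0 := (sub_pos.2 hx.2).ne'
    have := (hasDerivAt_id x).div ((hasDerivAt_id x).const_sub 1) h1
    refine (this.congr_deriv ?_).hasDerivWithinAt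
    simp only [id]
    field_simp
    ring
  have hinj : InjOn (fun x : ℝ => x / (1 - x)) (Ioo 0 1) := by
    intro x hx y hy hxy
    have h1 : 1 - x ≠ 0 := (sub_pos.2 hx.2).ne'
    have h2 : 1 - y ≠ 0 := (sub_pos.2 hy.2).ne'
    simp only at hxy
    rw [div_eq_div_iff h1 h2] at hxy
    linarith
  have hbeta : ProbabilityTheory.beta p (1 - p) = π / sin (p * π) := by
    rw [ProbabilityTheory.beta, add_sub_cancel, Gamma_one, div_one, Gamma_mul_Gamma_one_sub,
      mul_comm]
  rw [← himg, integral_image_eq_integral_abs_deriv_smul measurableSet_Ioo hderiv hinj, ← hbeta,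
    ProbabilityTheory.beta_eq_betaIntegralReal _ _ hp.1 (sub_pos.2 hp.2), Complex.betaIntegral,
    intervalIntegral.integral_of_le zero_le_one]
  have hcongr : ∀ x ∈ Ioo (0 : ℝ) 1, (x : ℂ) ^ ((p : ℂ) - 1) * (1 - (x : ℂ)) ^ (((1 - p : ℝ) : ℂ) - 1) =
      ((|((1 - x) ^ 2)⁻¹| • ((x / (1 - x)) ^ (p - 1) / (x / (1 - x) + 1)) : ℝ) : ℂ) := by
    intro x hx
    have hx1 : 0 < 1 - x := sub_pos.2 hx.2
    have h1 : (x : ℂ) ^ ((p : ℂ) - 1) * (1 - (x : ℂ)) ^ (((1 - p : ℝ) : ℂ) - 1) =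
        ((x ^ (p - 1) * (1 - x) ^ (-p) : ℝ) : ℂ) := by
      push_cast
      rw [Complex.ofReal_cpow hx.1.le, Complex.ofReal_cpow hx1.le]
      push_cast
      congr 2
      ring
    rw [h1]
    congr 1
    rw [smul_eq_mul, abs_of_pos (by positivity), div_rpow hx.1.le hx1.le, rpow_neg hx1.le,
      rpow_sub_one hx1.ne']
    have : 0 < (1 - x) ^ p := rpow_pos_of_pos hx1 p
    field_simp
    ring
  rw [integral_Ioc_eq_integral_Ioo,
    setIntegral_congr_fun measurableSet_Ioo hcongr, integral_complex_ofReal, Complex.ofReal_re]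

theorem integral_Ioi_one_eq_integral_inv (p y : ℝ) (hy : 0 < y) :
    ∫ t in Ioi (1 : ℝ), t ^ (p - 1) / (t + y) =
      ∫ x in (0 : ℝ)..1, (1 + x * y)⁻¹ * x ^ (-p) := by
  have himg : (fun x : ℝ => x⁻¹) '' Ioo 0 1 = Ioi 1 := by
    ext y
    constructor
    · rintro ⟨x, hx, rfl⟩
      exact (one_lt_inv₀ hx.1).2 hx.2
    · intro hy
      exact ⟨y⁻¹, ⟨inv_pos.2 (zero_lt_one.trans hy), inv_lt_one_of_one_lt₀ hy⟩, inv_inv y⟩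
  have hderiv : ∀ x ∈ Ioo (0 : ℝ) 1,
      HasDerivWithinAt (fun x : ℝ => x⁻¹) (-(x ^ 2)⁻¹) (Ioo 0 1) x := fun x hx =>
    (hasDerivAt_inv hx.1.ne').hasDerivWithinAt
  rw [← himg, integral_image_eq_integral_abs_deriv_smul measurableSet_Ioo hderiv
    (inv_injective.injOn), intervalIntegral.integral_of_le zero_le_one,
    integral_Ioc_eq_integral_Ioo]
  refine setIntegral_congr_fun measurableSet_Ioo fun x hx => ?_
  have hx0 := hx.1
  simp only [smul_eq_mul, abs_neg]
  rw [abs_of_pos (by positivity), inv_rpow hx0.le, rpow_neg hx0.le, rpow_sub_one hx0.ne']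
  have : 0 < x ^ p := rpow_pos_of_pos hx0 p
  field_simp

theorem sin_sub_one_mul_pi_pos {α : ℝ} (hα : α ∈ Ioo (1 : ℝ) 2) : 0 < sin ((α - 1) * π) :=
  sin_pos_of_pos_of_lt_pi (mul_pos (by linarith [hα.1]) pi_pos) (by nlinarith [hα.2, pi_pos])

/-- The integral representation of `λ ^ α μ ^ (1 - α)` for `α ∈ (1, 2)`. -/
theorem rpow_mul_rpow_eq_integral {α : ℝ} (hα : α ∈ Ioo (1 : ℝ) 2) {l k : ℝ} (hl : 0 < l)
    (hk : 0 < k) :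
    l ^ α * k ^ (1 - α) = sin ((α - 1) * π) / π *
      (l * (l / k * (∫ x in (0 : ℝ)..1, (x + l / k)⁻¹ * x ^ (α - 2)) +
        ∫ x in (0 : ℝ)..1, (x + k / l)⁻¹ * x ^ (1 - α))) := by
  have hp : α - 1 ∈ Ioo (0 : ℝ) 1 := ⟨by linarith [hα.1], by linarith [hα.2]⟩
  set y := l / k with hy
  have hy0 : 0 < y := by positivity
  have h1 := integral_rpowIntegrand₀₁_eq_rpow_mul_const hp hy0.le
  have hint := integrableOn_rpowIntegrand₀₁_Ioi hp hy0.le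
  -- This is the normalising constant: the integral at y is y^(α-1) times the integral at 1.
  have hI1 : ∫ t in Ioi (0 : ℝ), rpowIntegrand₀₁ (α - 1) t 1 = π / sin ((α - 1) * π) := by
    rw [← integral_Ioi_rpow_div_one_add hp]
    refine setIntegral_congr_fun measurableSet_Ioi fun t ht => ?_
    simpa using rpowIntegrand₀₁_eqOn_pow_div hp zero_le_one ht
  have hI : ∫ t in Ioi (0 : ℝ), rpowIntegrand₀₁ (α - 1) t y =
      y * (∫ x in (0 : ℝ)..1, (x + y)⁻¹ * x ^ (α - 2)) +
        ∫ x in (0 : ℝ)..1, (x + k / l)⁻¹ * x ^ (1 - α) := by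
    rw [← Ioc_union_Ioi_eq_Ioi zero_le_one, setIntegral_union Ioc_disjoint_Ioi_same
      measurableSet_Ioi (hint.mono_set Ioc_subset_Ioi_self)
      (hint.mono_set (Ioi_subset_Ioi zero_le_one))]
    congr 1
    · rw [intervalIntegral.integral_of_le zero_le_one, ← integral_const_mul]
      refine setIntegral_congr_fun measurableSet_Ioc fun t ht => ?_
      rw [rpowIntegrand₀₁_eq_pow_div hp ht.1.le hy0.le, show α - 1 - 1 = α - 2 by ring]
      ring
    · have h2 := integral_Ioi_one_eq_integral_inv (α - 1) y hy0
      have h3 : ∫ t in Ioi (1 : ℝ), rpowIntegrand₀₁ (α - 1) t y =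
          y * ∫ t in Ioi (1 : ℝ), t ^ (α - 1 - 1) / (t + y) := by
        rw [← integral_const_mul]
        refine setIntegral_congr_fun measurableSet_Ioi fun t ht => ?_
        have ht0 : (0 : ℝ) ≤ t := zero_le_one.trans (le_of_lt ht)
        rw [rpowIntegrand₀₁_eq_pow_div hp ht0 hy0.le]
        ring
      rw [h3, h2, ← intervalIntegral.integral_const_mul]
      refine intervalIntegral.integral_congr fun x hx => ?_
      rw [uIcc_of_le zero_le_one] at hx
      have hx0 := hx.1
      rw [← mul_assoc, neg_sub]
      congr 1
      rw [hy]
      field_simp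
      ring
  rw [hI1, hI] at h1
  have hsin := sin_sub_one_mul_pi_pos hα
  have h2 : l ^ α * k ^ (1 - α) = l * y ^ (α - 1) := by
    rw [hy, div_rpow hl.le hk.le, show (1 - α) = -(α - 1) by ring, rpow_neg hk.le,
      rpow_sub_one hl.ne']
    field_simp
  rw [h2, h1]
  have := pi_pos
  field_simp

theorem IsGaussRadauJacobi.sum_weights {α : ℝ} (hα : α ∈ Ioo (1 : ℝ) 2) {m : ℕ} {t w : ℕ → ℝ}
    (h : IsGaussRadauJacobi (α - 2) m t w) : ∑ i ∈ Finset.Icc 1 m, w i = 1 / (α - 1) := by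
  have h1 := h.exact_quadrature 1 (by simp)
  have h2 : α - 2 + 1 = α - 1 := by ring
  have h3 : α - 1 ≠ 0 := by linarith [hα.1]
  simp only [Polynomial.eval_one, mul_one, one_mul] at h1
  rw [h1, integral_rpow (Or.inl (by linarith [hα.1])), h2, one_rpow, zero_rpow h3, sub_zero]

/-- The contribution of a pair `(l, k)` of eigenvalues of `ρ` and `σ` to the upper bound. -/
noncomputable def scalarBound (α : ℝ) (m : ℕ) (t w t' w' : ℕ → ℝ) (l k : ℝ) : ℝ :=
  l / (α - 1) + ∑ i ∈ Finset.Icc 1 m, w' i * (l ^ 2 / (t' i * l + k)) -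
    ∑ i ∈ Finset.Icc 1 m, w i * (t i * l * k / (l + t i * k))

/-- Exactness on constants turns l/(α - 1) into ∑ wᵢ l, and l - tlk/(l + tk) = l²/(l + tk) then
gives the quadrature terms for x^(α-2). -/
theorem scalarBound_eq {α : ℝ} (hα : α ∈ Ioo (1 : ℝ) 2) {m : ℕ} {t w t' w' : ℕ → ℝ}
    (h : IsGaussRadauJacobi (α - 2) m t w) (h' : IsGaussRadauJacobi (1 - α) m t' w')
    {l k : ℝ} (hl : 0 < l) (hk : 0 < k) :
    scalarBound α m t w t' w' l k =
      l * (l / k * (∑ i ∈ Finset.Icc 1 m, w i * (t i + l / k)⁻¹) +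
        ∑ i ∈ Finset.Icc 1 m, w' i * (t' i + k / l)⁻¹) := by
  have hβ : -1 < α - 2 := by linarith [hα.1]
  have hβ' : -1 < 1 - α := by linarith [hα.2]
  rw [scalarBound, div_eq_mul_one_div, ← h.sum_weights hα, add_sub_right_comm, mul_add]
  congr 1
  · rw [Finset.mul_sum, ← Finset.sum_sub_distrib, Finset.mul_sum, Finset.mul_sum]
    refine Finset.sum_congr rfl fun i hi => ?_
    have ht := (h.node_mem_Ico hβ hi).1
    have h1 : l + t i * k ≠ 0 := by positivity
    have h2 : t i + l / k ≠ 0 := by positivity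
    have h3 : t i * k + l ≠ 0 := by positivity
    field_simp
    ring
  · rw [Finset.mul_sum]
    refine Finset.sum_congr rfl fun i hi => ?_
    have ht := (h'.node_mem_Ico hβ' hi).1
    have h1 : t' i * l + k ≠ 0 := by positivity
    have h2 : t' i + k / l ≠ 0 := by positivity
    field_simp

theorem rpow_mul_rpow_le_scalarBound {α : ℝ} (hα : α ∈ Ioo (1 : ℝ) 2) {m : ℕ}
    {t w t' w' : ℕ → ℝ} (h : IsGaussRadauJacobi (α - 2) m t w)
    (h' : IsGaussRadauJacobi (1 - α) m t' w') {l k : ℝ} (hl : 0 < l) (hk : 0 < k) :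
    l ^ α * k ^ (1 - α) ≤ sin ((α - 1) * π) / π * scalarBound α m t w t' w' l k := by
  have hβ : -1 < α - 2 := by linarith [hα.1]
  have hβ' : -1 < 1 - α := by linarith [hα.2]
  have h1 := sin_sub_one_mul_pi_pos hα
  rw [rpow_mul_rpow_eq_integral hα hl hk, scalarBound_eq hα h h' hl hk]
  gcongr
  · exact h.integral_le_sum_inv hβ (by positivity)
  · exact h'.integral_le_sum_inv hβ' (by positivity)

theorem tendsto_scalarBound {α : ℝ} (hα : α ∈ Ioo (1 : ℝ) 2) {t w t' w' : ℕ → ℕ → ℝ}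
    (h : ∀ m : ℕ, 1 ≤ m → IsGaussRadauJacobi (α - 2) m (t m) (w m))
    (h' : ∀ m : ℕ, 1 ≤ m → IsGaussRadauJacobi (1 - α) m (t' m) (w' m))
    {l k : ℝ} (hl : 0 < l) (hk : 0 < k) :
    Tendsto (fun m => sin ((α - 1) * π) / π * scalarBound α m (t m) (w m) (t' m) (w' m) l k) atTop
      (𝓝 (l ^ α * k ^ (1 - α))) := by
  have hβ : -1 < α - 2 := by linarith [hα.1]
  have hβ' : -1 < 1 - α := by linarith [hα.2]
  have hcont : ∀ a : ℝ, 0 < a → ContinuousOn (fun x : ℝ => (x + a)⁻¹) (Icc 0 1) := fun a ha =>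
    ContinuousOn.inv₀ (by fun_prop) fun x hx => by have := hx.1; positivity
  have h1 := tendsto_quadrature hβ h (hcont (l / k) (by positivity))
  have h2 := tendsto_quadrature hβ' h' (hcont (k / l) (by positivity))
  rw [rpow_mul_rpow_eq_integral hα hl hk]
  refine ((((h1.const_mul (l / k)).add h2).const_mul l).const_mul _).congr' ?_
  filter_upwards [eventually_ge_atTop 1] with m hm
  rw [scalarBound_eq hα (h m hm) (h' m hm) hl hk]

end Scalar

/-! ### Traces and objectives in a pair of eigenbases. -/

section Spectral

open Polynomial

variable {H : Type*} [NormedAddCommGroup H] [InnerProductSpace ℂ H] {ι : Type*} [Fintype ι]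

theorem aeval_apply_of_apply_eq_smul {a : H →L[ℂ] H} {x : H} {l : ℝ} (hx : a x = (l : ℂ) • x)
    (p : ℝ[X]) : aeval a p x = ((p.eval l : ℝ) : ℂ) • x := by
  induction p using Polynomial.induction_on with
  | C c => simp [Algebra.algebraMap_eq_smul_one]
  | add p q hp hq => simp [hp, hq, add_smul]
  | monomial n c h =>
    have h1 : (aeval a (C c * X ^ (n + 1))) x = aeval a (C c * X ^ n) (a x) := by
      simp [pow_succ]
    rw [h1, hx, map_smul, h, smul_smul]
    congr 1
    simp only [eval_mul, eval_C, eval_pow, eval_X]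
    push_cast
    ring

theorem tr_eq_sum_inner (e : OrthonormalBasis ι ℂ H) (A : H →L[ℂ] H) :
    tr A = ∑ j, (inner ℂ (e j) (A (e j))).re := by
  rw [tr, LinearMap.trace_eq_sum_inner _ e, Complex.re_sum]
  rfl

theorem tr_mul_of_apply_eq_smul {e : OrthonormalBasis ι ℂ H} {a : H →L[ℂ] H} {l : ι → ℝ}
    (ha : ∀ j, a (e j) = (l j : ℂ) • e j) (A : H →L[ℂ] H) :
    tr (a * A) = ∑ j, l j * (inner ℂ (e j) (A (e j))).re := by
  have h : tr (a * A) = tr (A * a) :=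
    congrArg Complex.re (LinearMap.trace_mul_comm ℂ (a : H →ₗ[ℂ] H) (A : H →ₗ[ℂ] H))
  rw [h, tr_eq_sum_inner e]
  refine Finset.sum_congr rfl fun j _ => ?_
  rw [mul_apply_eq_comp, ha, map_smul, inner_smul_right, Complex.re_ofReal_mul]

theorem re_inner_apply_self {f : OrthonormalBasis ι ℂ H} {b : H →L[ℂ] H} {s : ι → ℝ}
    (hb : ∀ k, b (f k) = (s k : ℂ) • f k) (x : H) :
    (inner ℂ x (b x)).re = ∑ k, s k * ‖inner ℂ (f k) x‖ ^ 2 := by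
  conv_lhs => rw [← f.sum_repr' x, map_sum, f.sum_repr' x]
  rw [inner_sum, Complex.re_sum]
  refine Finset.sum_congr rfl fun k _ => ?_
  rw [map_smul, hb, inner_smul_right, inner_smul_right, mul_left_comm, Complex.re_ofReal_mul,
    mul_comm (inner ℂ (f k) x), ← inner_conj_symm x, ← Complex.normSq_eq_conj_mul_self,
    Complex.ofReal_re, Complex.sq_norm]

theorem exists_eigenbasis [FiniteDimensional ℂ H] {a : H →L[ℂ] H} (h : a.IsPositive) :
    ∃ (e : OrthonormalBasis (Fin (Module.finrank ℂ H)) ℂ H) (l : Fin (Module.finrank ℂ H) → ℝ),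
      (∀ j, 0 ≤ l j) ∧ ∀ j, a (e j) = (l j : ℂ) • e j :=
  ⟨h.toLinearMap.isSymmetric.eigenvectorBasis rfl, h.toLinearMap.isSymmetric.eigenvalues rfl,
    h.toLinearMap.nonneg_eigenvalues rfl,
    h.toLinearMap.isSymmetric.apply_eigenvectorBasis rfl⟩

theorem tr_smul (c : ℝ) (A : H →L[ℂ] H) : tr ((c : ℂ) • A) = c * tr A := by
  simp [tr]

/-- The entries ⟨f k, Z (e j)⟩ may be prescribed freely, so minimising entry by entry is attained by
a single operator. -/
theorem isLeast_range_of_eq_sum [FiniteDimensional ℂ H] {F : (H →L[ℂ] H) → ℝ} {φ : ι → ι → ℂ → ℝ}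
    {e f : OrthonormalBasis ι ℂ H} {v : ι → ι → ℝ}
    (hF : ∀ Z, F Z = ∑ j, ∑ k, φ j k (inner ℂ (f k) (Z (e j))))
    (hφ : ∀ j k, IsLeast (Set.range (φ j k)) (v j k)) :
    IsLeast (Set.range F) (∑ j, ∑ k, v j k) := by
  constructor
  · choose z hz using fun j k => (hφ j k).1
    refine ⟨LinearMap.toContinuousLinearMap
      (e.toBasis.constr ℂ fun j => ∑ k, z j k • f k), ?_⟩
    rw [hF]
    refine Finset.sum_congr rfl fun j _ => Finset.sum_congr rfl fun k _ => ?_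
    rw [← hz j k]
    congr 1
    have h1 : (e.toBasis.constr ℂ fun j => ∑ k, z j k • f k) (e j) = ∑ k, z j k • f k := by
      have := e.toBasis.constr_basis ℂ (fun j => ∑ k, z j k • f k) j
      simpa using this
    rw [LinearMap.coe_toContinuousLinearMap', h1]
    exact f.orthonormal.inner_right_fintype _ _
  · rintro _ ⟨Z, rfl⟩
    rw [hF]
    exact Finset.sum_le_sum fun j _ => Finset.sum_le_sum fun k _ => (hφ j k).2 ⟨_, rfl⟩

variable [CompleteSpace H]

/-- The spectrum lies in the finite set of eigenvalues, where x ^ y agrees with a Lagrange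
interpolant; this reduces the functional calculus to a polynomial in `a`. -/
theorem rpow_apply_eigenbasis {e : OrthonormalBasis ι ℂ H} {a : H →L[ℂ] H} (h0 : a.IsPositive)
    {l : ι → ℝ} (ha : ∀ j, a (e j) = (l j : ℂ) • e j) (y : ℝ) (i : ι) :
    (a ^ y) (e i) = ((l i ^ y : ℝ) : ℂ) • e i := by
  classical
  have ha0 : 0 ≤ a := (ContinuousLinearMap.nonneg_iff_isPositive a).2 h0
  have hsa : IsSelfAdjoint a := h0.isSelfAdjoint
  let S : Finset ℝ := Finset.univ.image l
  let p : ℝ[X] := Lagrange.interpolate S id (fun x => x ^ y)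
  have hp : ∀ x ∈ S, p.eval x = x ^ y := fun x hx =>
    Lagrange.eval_interpolate_at_node (v := id) (fun x : ℝ => x ^ y) (Set.injOn_id _) hx
  have hS : spectrum ℝ a ⊆ S := by
    intro x hx
    let N : ℝ[X] := ∏ z ∈ S, (X - C z)
    have hN : aeval a N = 0 := by
      have : ((aeval a N : H →L[ℂ] H) : H →ₗ[ℂ] H) = 0 := by
        refine e.toBasis.ext fun j => ?_
        have hz : N.eval (l j) = 0 := by
          simp only [N, eval_prod]
          exact Finset.prod_eq_zero (Finset.mem_image_of_mem l (Finset.mem_univ j)) (by simp)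
        have := aeval_apply_of_apply_eq_smul (ha j) N
        rw [hz] at this
        simpa using this
      exact ContinuousLinearMap.coe_injective this
    have h1 := spectrum.subset_polynomial_aeval a N ⟨x, hx, rfl⟩
    have h2 : Nontrivial (H →L[ℂ] H) := by
      by_contra hn
      rw [not_nontrivial_iff_subsingleton] at hn
      simp [spectrum.of_subsingleton] at hx
    rw [hN, spectrum.zero_eq, Set.mem_singleton_iff] at h1
    simp only [N, eval_prod, Finset.prod_eq_zero_iff, eval_sub, eval_X, eval_C] at h1
    obtain ⟨z, hz, hxz⟩ := h1
    rw [sub_eq_zero.1 hxz]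
    exact hz
  have h1 : a ^ y = aeval a p := by
    rw [CFC.rpow_eq_cfc_real ha0, ← cfc_polynomial p a]
    exact cfc_congr fun x hx => (hp x (hS hx)).symm
  rw [h1, aeval_apply_of_apply_eq_smul (ha i),
    hp _ (Finset.mem_image_of_mem l (Finset.mem_univ i))]

variable {e f : OrthonormalBasis ι ℂ H} {ρ σ : H →L[ℂ] H} {l s : ι → ℝ}

theorem petzTrace_eq_sum (hρ : ρ.IsPositive) (hσ : σ.IsPositive)
    (he : ∀ j, ρ (e j) = (l j : ℂ) • e j) (hf : ∀ k, σ (f k) = (s k : ℂ) • f k) (α : ℝ) :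
    petzTrace ρ σ α =
      ∑ j, ∑ k, l j ^ α * s k ^ (1 - α) * ‖inner ℂ (f k) (e j)‖ ^ 2 := by
  rw [petzTrace, tr_mul_of_apply_eq_smul (rpow_apply_eigenbasis hρ he α)]
  simp only [re_inner_apply_self (rpow_apply_eigenbasis hσ hf (1 - α)), Finset.mul_sum, mul_assoc]

theorem tr_mul_star_mul_self (he : ∀ j, ρ (e j) = (l j : ℂ) • e j) (f : OrthonormalBasis ι ℂ H)
    (A : H →L[ℂ] H) :
    tr (ρ * (star A * A)) = ∑ j, ∑ k, l j * ‖inner ℂ (f k) (A (e j))‖ ^ 2 := by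
  rw [tr_mul_of_apply_eq_smul he]
  refine Finset.sum_congr rfl fun j _ => ?_
  rw [← Finset.mul_sum, f.sum_sq_norm_inner_right, mul_apply_eq_comp,
    ContinuousLinearMap.star_eq_adjoint, ContinuousLinearMap.adjoint_inner_right]
  congr 1
  exact inner_self_eq_norm_sq (𝕜 := ℂ) (A (e j))

theorem tr_mul_self_mul_star (e : OrthonormalBasis ι ℂ H) (hf : ∀ k, σ (f k) = (s k : ℂ) • f k)
    (A : H →L[ℂ] H) :
    tr (σ * (A * star A)) = ∑ j, ∑ k, s k * ‖inner ℂ (f k) (A (e j))‖ ^ 2 := by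
  have h := tr_mul_star_mul_self hf e (star A)
  rw [star_star] at h
  rw [h, Finset.sum_comm]
  refine Finset.sum_congr rfl fun j _ => Finset.sum_congr rfl fun k _ => ?_
  rw [ContinuousLinearMap.star_eq_adjoint, ContinuousLinearMap.adjoint_inner_right,
    norm_inner_symm]

theorem objFirst_eq_sum (he : ∀ j, ρ (e j) = (l j : ℂ) • e j)
    (hf : ∀ k, σ (f k) = (s k : ℂ) • f k) (r : ℝ) (Z : H →L[ℂ] H) :
    objFirst ρ σ r Z = ∑ j, ∑ k, (l j * ‖inner ℂ (f k) (Z (e j))‖ ^ 2 +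
      r * s k * ‖inner ℂ (f k) (e j) + inner ℂ (f k) (Z (e j))‖ ^ 2) := by
  have h : (1 + star Z : H →L[ℂ] H) = star (1 + Z) := by simp
  rw [objFirst, mul_smul_comm, tr_smul, h, tr_mul_star_mul_self he f, tr_mul_self_mul_star e hf]
  simp only [Finset.mul_sum, ← Finset.sum_add_distrib, add_apply,
    one_apply_eq_self, inner_add_right, mul_assoc]

theorem objSecond_eq_sum (he : ∀ j, ρ (e j) = (l j : ℂ) • e j)
    (hf : ∀ k, σ (f k) = (s k : ℂ) • f k) (r : ℝ) (Z : H →L[ℂ] H) :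
    objSecond ρ σ r Z = ∑ j, ∑ k, (1 / r * s k * ‖inner ℂ (f k) (Z (e j))‖ ^ 2 +
      l j * ‖inner ℂ (f k) (e j) + inner ℂ (f k) (Z (e j))‖ ^ 2) := by
  have h : (1 + star Z : H →L[ℂ] H) = star (1 + Z) := by simp
  rw [objSecond, h, tr_mul_star_mul_self he f, tr_mul_self_mul_star e hf, add_comm]
  simp only [Finset.mul_sum, ← Finset.sum_add_distrib, add_apply,
    one_apply_eq_self, inner_add_right, mul_assoc]

theorem objEnd_eq_sum (he : ∀ j, ρ (e j) = (l j : ℂ) • e j)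
    (hf : ∀ k, σ (f k) = (s k : ℂ) • f k) (Z : H →L[ℂ] H) :
    objEnd ρ σ Z = ∑ j, ∑ k,
      (2 * l j * (inner ℂ (e j) (f k) * inner ℂ (f k) (Z (e j))).re +
        s k * ‖inner ℂ (f k) (Z (e j))‖ ^ 2) := by
  rw [objEnd, tr_mul_of_apply_eq_smul he, tr_mul_self_mul_star e hf]
  -- Summing over k by completeness of `f` collapses the cross term to Re ⟨e j, Z (e j)⟩.
  simp only [Finset.sum_add_distrib, ← Finset.mul_sum, ← Complex.re_sum,
    f.sum_inner_mul_inner]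
  congr 1
  refine Finset.sum_congr rfl fun j _ => ?_
  rw [add_apply, inner_add_right, ContinuousLinearMap.star_eq_adjoint,
    ContinuousLinearMap.adjoint_inner_right, Complex.add_re, ← inner_conj_symm (Z (e j)),
    Complex.conj_re]
  ring

theorem isLeast_range_sq_add_sq {a b : ℝ} (ha : 0 ≤ a) (hb : 0 ≤ b) (c : ℂ) :
    IsLeast (Set.range fun z : ℂ => a * ‖z‖ ^ 2 + b * ‖c + z‖ ^ 2)
      (a * b / (a + b) * ‖c‖ ^ 2) := by
  rcases (add_nonneg ha hb).eq_or_lt with h | h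
  · obtain rfl : a = 0 := by linarith
    obtain rfl : b = 0 := by linarith
    exact ⟨⟨0, by simp⟩, by rintro _ ⟨z, rfl⟩; simp⟩
  · have key : ∀ z : ℂ, a * ‖z‖ ^ 2 + b * ‖c + z‖ ^ 2 = a * b / (a + b) * ‖c‖ ^ 2 +
        (a + b) * ‖z + ((b / (a + b) : ℝ) : ℂ) * c‖ ^ 2 := by
      intro z
      simp only [Complex.sq_norm, Complex.normSq_apply, Complex.add_re, Complex.add_im,
        Complex.re_ofReal_mul, Complex.im_ofReal_mul]
      field_simp
      ring
    refine ⟨⟨-(((b / (a + b) : ℝ) : ℂ) * c), ?_⟩, ?_⟩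
    · simp only [key]; simp
    · rintro _ ⟨z, rfl⟩
      simp only [key]
      exact le_add_of_nonneg_right (by positivity)

/-- Complete the square when b > 0. For b = 0 the function is linear, and `h0` makes it zero,
matching a² / 0 = 0. -/
theorem isLeast_range_linear_add_sq {a b : ℝ} (hb : 0 ≤ b) {c : ℂ} (h0 : b = 0 → a = 0 ∨ c = 0) :
    IsLeast (Set.range fun z : ℂ => 2 * a * (star c * z).re + b * ‖z‖ ^ 2)
      (-(a ^ 2 / b) * ‖c‖ ^ 2) := by
  rcases hb.eq_or_lt with h | h
  · subst h
    rcases h0 rfl with rfl | rfl <;> exact ⟨⟨0, by simp⟩, by rintro _ ⟨z, rfl⟩; simp⟩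
  · have key : ∀ z : ℂ, 2 * a * (star c * z).re + b * ‖z‖ ^ 2 = -(a ^ 2 / b) * ‖c‖ ^ 2 +
        b * ‖z + ((a / b : ℝ) : ℂ) * c‖ ^ 2 := by
      intro z
      simp only [Complex.sq_norm, Complex.normSq_apply, Complex.add_re, Complex.add_im,
        Complex.mul_im, Complex.ofReal_re, Complex.ofReal_im, Complex.mul_re, Complex.star_def,
        Complex.conj_re, Complex.conj_im]
      field_simp
      ring
    refine ⟨⟨-(((a / b : ℝ) : ℂ) * c), ?_⟩, ?_⟩
    · simp only [key]; simp
    · rintro _ ⟨z, rfl⟩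
      simp only [key]
      exact le_add_of_nonneg_right (by positivity)

end Spectral

/-! ### The upper bound as a weighted sum of scalar bounds. -/

section Bound

variable {H : Type*} [NormedAddCommGroup H] [InnerProductSpace ℂ H]
  {ι : Type*} [Fintype ι] {e f : OrthonormalBasis ι ℂ H} {ρ σ : H →L[ℂ] H} {l s : ι → ℝ}

/-- If s k = 0, then f k lies in ker σ ⊆ ker ρ, and symmetry of ρ gives l j ⟨f k, e j⟩ = 0. This
keeps the endpoint infimum finite. -/
theorem Dominated.eq_zero_or_inner_eq_zero (h : Dominated ρ σ) (hρ : ρ.IsPositive)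
    (he : ∀ j, ρ (e j) = (l j : ℂ) • e j) (hf : ∀ k, σ (f k) = (s k : ℂ) • f k) (j k : ι)
    (hs : s k = 0) : l j = 0 ∨ inner ℂ (f k) (e j) = 0 := by
  have h1 : σ (f k) = 0 := by rw [hf, hs]; simp
  have h2 : ρ (f k) = 0 := h h1
  have h3 : inner ℂ (ρ (f k)) (e j) = inner ℂ (f k) (ρ (e j)) := hρ.isSymmetric (f k) (e j)
  rw [h2, he, inner_zero_left, inner_smul_right] at h3
  simpa using h3.symm

theorem tr_eq_sum_sum (he : ∀ j, ρ (e j) = (l j : ℂ) • e j) (f : OrthonormalBasis ι ℂ H) :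
    tr ρ = ∑ j, ∑ k, l j * ‖inner ℂ (f k) (e j)‖ ^ 2 := by
  rw [← mul_one ρ, tr_mul_of_apply_eq_smul he]
  refine Finset.sum_congr rfl fun j _ => ?_
  rw [← Finset.mul_sum, f.sum_sq_norm_inner_right, one_apply_eq_self]
  congr 1
  exact inner_self_eq_norm_sq (𝕜 := ℂ) (e j)

theorem sum_mul_sum_sum (S : Finset ℕ) (w : ℕ → ℝ) (v : ℕ → ι → ι → ℝ) :
    ∑ i ∈ S, w i * ∑ j, ∑ k, v i j k = ∑ j, ∑ k, ∑ i ∈ S, w i * v i j k := by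
  simp only [Finset.mul_sum]
  rw [Finset.sum_comm]
  exact Finset.sum_congr rfl fun j _ => Finset.sum_comm

theorem sum_Icc_one_eq {m : ℕ} (hm : 1 ≤ m) (g : ℕ → ℝ) :
    ∑ i ∈ Finset.Icc 1 m, g i = g 1 + ∑ i ∈ Finset.Icc 2 m, g i := by
  have h : Finset.Icc 1 m = insert 1 (Finset.Icc 2 m) := by
    ext i; simp only [Finset.mem_Icc, Finset.mem_insert]; omega
  rw [h, Finset.sum_insert (by simp)]

/-- Merges the w'ᵢ/t'ᵢ part of C_m with the matching infimum into one quadrature term. -/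
theorem div_mul_sub_eq {l k t w : ℝ} (hl : 0 ≤ l) (hk : 0 ≤ k) (ht : 0 < t) :
    w / t * l - w / t * (1 / t * k * l / (1 / t * k + l)) = w * (l ^ 2 / (t * l + k)) := by
  rcases hl.eq_or_lt with rfl | hl
  · simp
  · have h1 : t * l + k ≠ 0 := by positivity
    have h2 : 1 / t * k + l ≠ 0 := by positivity
    have h3 : k + t * l ≠ 0 := by positivity
    field_simp
    ring

variable [CompleteSpace H]

theorem isLeast_range_objFirst [FiniteDimensional ℂ H] (he : ∀ j, ρ (e j) = (l j : ℂ) • e j)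
    (hf : ∀ k, σ (f k) = (s k : ℂ) • f k) (hl : ∀ j, 0 ≤ l j) (hs : ∀ k, 0 ≤ s k)
    {r : ℝ} (hr : 0 ≤ r) :
    IsLeast (Set.range (objFirst ρ σ r))
      (∑ j, ∑ k, l j * (r * s k) / (l j + r * s k) * ‖inner ℂ (f k) (e j)‖ ^ 2) :=
  isLeast_range_of_eq_sum (objFirst_eq_sum he hf r) fun j k =>
    isLeast_range_sq_add_sq (hl j) (mul_nonneg hr (hs k)) _

theorem isLeast_range_objSecond [FiniteDimensional ℂ H] (he : ∀ j, ρ (e j) = (l j : ℂ) • e j)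
    (hf : ∀ k, σ (f k) = (s k : ℂ) • f k) (hl : ∀ j, 0 ≤ l j) (hs : ∀ k, 0 ≤ s k)
    {r : ℝ} (hr : 0 ≤ r) :
    IsLeast (Set.range (objSecond ρ σ r))
      (∑ j, ∑ k, 1 / r * s k * l j / (1 / r * s k + l j) * ‖inner ℂ (f k) (e j)‖ ^ 2) :=
  isLeast_range_of_eq_sum (objSecond_eq_sum he hf r) fun j k =>
    isLeast_range_sq_add_sq (mul_nonneg (one_div_nonneg.2 hr) (hs k)) (hl j) _

theorem isLeast_range_objEnd [FiniteDimensional ℂ H] (he : ∀ j, ρ (e j) = (l j : ℂ) • e j)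
    (hf : ∀ k, σ (f k) = (s k : ℂ) • f k) (hs : ∀ k, 0 ≤ s k)
    (h0 : ∀ j k, s k = 0 → l j = 0 ∨ inner ℂ (f k) (e j) = 0) :
    IsLeast (Set.range (objEnd ρ σ))
      (∑ j, ∑ k, -(l j ^ 2 / s k) * ‖inner ℂ (f k) (e j)‖ ^ 2) := by
  refine isLeast_range_of_eq_sum (φ := fun j k z =>
    2 * l j * (inner ℂ (e j) (f k) * z).re + s k * ‖z‖ ^ 2) (objEnd_eq_sum he hf) fun j k => ?_
  have := isLeast_range_linear_add_sq (a := l j) (hs k) (h0 j k)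
  rwa [Complex.star_def, inner_conj_symm] at this

theorem upperBound_eq_sum [FiniteDimensional ℂ H] (he : ∀ j, ρ (e j) = (l j : ℂ) • e j)
    (hf : ∀ k, σ (f k) = (s k : ℂ) • f k) (hl : ∀ j, 0 ≤ l j) (hs : ∀ k, 0 ≤ s k)
    (h0 : ∀ j k, s k = 0 → l j = 0 ∨ inner ℂ (f k) (e j) = 0)
    {α : ℝ} (hα : α ∈ Set.Ioo (1 : ℝ) 2) {m : ℕ} {t w t' w' : ℕ → ℝ}
    (h : IsGaussRadauJacobi (α - 2) m t w) (h' : IsGaussRadauJacobi (1 - α) m t' w') :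
    upperBound ρ σ α m t w t' w' = ∑ j, ∑ k,
      Real.sin ((α - 1) * Real.pi) / Real.pi * scalarBound α m t w t' w' (l j) (s k) *
        ‖inner ℂ (f k) (e j)‖ ^ 2 := by
  have hβ : -1 < α - 2 := by linarith [hα.1]
  have hβ' : -1 < 1 - α := by linarith [hα.2]
  -- The prefactor of the infima is negative, so they enter with a minus sign relative to C_m.
  have hsin : Real.sin (α * Real.pi) = -Real.sin ((α - 1) * Real.pi) := by
    rw [sub_mul, one_mul, Real.sin_sub_pi, neg_neg]
  have h1 : ∀ i ∈ Finset.Icc 2 m, w i * (⨅ Z : H →L[ℂ] H, objFirst ρ σ (t i) Z) = w i *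
      ∑ j, ∑ k, l j * (t i * s k) / (l j + t i * s k) * ‖inner ℂ (f k) (e j)‖ ^ 2 :=
    fun i hi => congrArg (w i * ·)
      (isLeast_range_objFirst he hf hl hs (h.node_mem_Ioo hβ hi).1.le).csInf_eq
  have h2 : ∀ i ∈ Finset.Icc 2 m,
      w' i / t' i * (⨅ Z : H →L[ℂ] H, objSecond ρ σ (t' i) Z) = w' i / t' i *
      ∑ j, ∑ k, 1 / t' i * s k * l j / (1 / t' i * s k + l j) * ‖inner ℂ (f k) (e j)‖ ^ 2 :=
    fun i hi => congrArg (w' i / t' i * ·)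
      (isLeast_range_objSecond he hf hl hs (h'.node_mem_Ioo hβ' hi).1.le).csInf_eq
  have h3 : (⨅ Z : H →L[ℂ] H, objEnd ρ σ Z) =
      ∑ j, ∑ k, -(l j ^ 2 / s k) * ‖inner ℂ (f k) (e j)‖ ^ 2 :=
    (isLeast_range_objEnd he hf hs h0).csInf_eq
  rw [upperBound, constTerm, Finset.sum_congr rfl h1, Finset.sum_congr rfl h2, h3,
    tr_eq_sum_sum he f, hsin, sum_mul_sum_sum, sum_mul_sum_sum]
  rw [mul_assoc, mul_comm (∑ j, ∑ k, l j * ‖inner ℂ (f k) (e j)‖ ^ 2), ← mul_assoc]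
  simp only [Finset.mul_sum (s := (Finset.univ : Finset ι)), ← Finset.sum_add_distrib]
  refine Finset.sum_congr rfl fun j _ => Finset.sum_congr rfl fun k _ => ?_
  set n := ‖inner ℂ (f k) (e j)‖ ^ 2
  -- The sum may start at 1 because the term of the node 0 vanishes.
  have hA : ∑ i ∈ Finset.Icc 2 m, w i * (l j * (t i * s k) / (l j + t i * s k) * n) =
      (∑ i ∈ Finset.Icc 1 m, w i * (t i * l j * s k / (l j + t i * s k))) * n := by
    rw [sum_Icc_one_eq h.one_le, h.endpoint]
    simp only [zero_mul, zero_div, mul_zero, zero_add, Finset.sum_mul]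
    exact Finset.sum_congr rfl fun i _ => by ring
  have hB : ∑ i ∈ Finset.Icc 1 m, w' i * (l j ^ 2 / (t' i * l j + s k)) =
      w' 1 * (l j ^ 2 / s k) + ((∑ i ∈ Finset.Icc 2 m, w' i / t' i) * l j -
        ∑ i ∈ Finset.Icc 2 m, w' i / t' i * (1 / t' i * s k * l j / (1 / t' i * s k + l j))) := by
    rw [sum_Icc_one_eq h'.one_le, h'.endpoint, zero_mul, zero_add, Finset.sum_mul,
      ← Finset.sum_sub_distrib]
    congr 1
    exact Finset.sum_congr rfl fun i hi =>
      (div_mul_sub_eq (hl j) (hs k) (h'.node_mem_Ioo hβ' hi).1).symm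
  rw [hA, scalarBound, hB]
  simp only [← mul_assoc (w' _ / t' _), ← Finset.sum_mul]
  ring

theorem scalarBound_zero_left (α : ℝ) (m : ℕ) (t w t' w' : ℕ → ℝ) (k : ℝ) :
    scalarBound α m t w t' w' 0 k = 0 := by
  simp [scalarBound]

end Bound

end PetzRenyi

theorem theorem2 {H : Type*} [NormedAddCommGroup H] [InnerProductSpace ℂ H] [CompleteSpace H]
    [FiniteDimensional ℂ H] (ρ σ : H →L[ℂ] H) (hρ : ρ.IsPositive) (hσ : σ.IsPositive)
    (hρσ : PetzRenyi.Dominated ρ σ) (α : ℝ) (hα : α ∈ Set.Ioo (1 : ℝ) 2) :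
    -- the infima are genuine: every objective is bounded below
    (BddBelow (Set.range (PetzRenyi.objEnd ρ σ)) ∧
      ∀ s : ℝ, 0 < s → BddBelow (Set.range (PetzRenyi.objFirst ρ σ s)) ∧
        BddBelow (Set.range (PetzRenyi.objSecond ρ σ s))) ∧
    -- the quadratures exist
    (∀ m : ℕ, 1 ≤ m →
      (∃ t w : ℕ → ℝ, PetzRenyi.IsGaussRadauJacobi (α - 2) m t w) ∧
      (∃ t' w' : ℕ → ℝ, PetzRenyi.IsGaussRadauJacobi (1 - α) m t' w')) ∧
    -- location of the nodes, positivity of the weights, and the upper bound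
    (∀ (m : ℕ) (t w t' w' : ℕ → ℝ),
      PetzRenyi.IsGaussRadauJacobi (α - 2) m t w →
      PetzRenyi.IsGaussRadauJacobi (1 - α) m t' w' →
      (∀ i ∈ Set.Icc 1 m, t i ∈ Set.Ico (0 : ℝ) 1 ∧ t' i ∈ Set.Ico (0 : ℝ) 1 ∧
        0 < w i ∧ 0 < w' i) ∧
      PetzRenyi.petzTrace ρ σ α ≤ PetzRenyi.upperBound ρ σ α m t w t' w') ∧
    -- convergence of the bound as the number of nodes grows
    (∀ t w t' w' : ℕ → ℕ → ℝ,
      (∀ m : ℕ, 1 ≤ m → PetzRenyi.IsGaussRadauJacobi (α - 2) m (t m) (w m)) →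
      (∀ m : ℕ, 1 ≤ m → PetzRenyi.IsGaussRadauJacobi (1 - α) m (t' m) (w' m)) →
      Tendsto (fun m => PetzRenyi.upperBound ρ σ α m (t m) (w m) (t' m) (w' m)) atTop
        (𝓝 (PetzRenyi.petzTrace ρ σ α))) := by
  have hβ : -1 < α - 2 := by linarith [hα.1]
  have hβ' : -1 < 1 - α := by linarith [hα.2]
  have hα0 : α ≠ 0 := by linarith [hα.1]
  obtain ⟨e, l, hl, he⟩ := PetzRenyi.exists_eigenbasis hρ
  obtain ⟨f, s, hs, hf⟩ := PetzRenyi.exists_eigenbasis hσ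
  have h0 := hρσ.eq_zero_or_inner_eq_zero hρ he hf
  -- Pairs with zero overlap or l j = 0 contribute nothing to either side; the rest have both
  -- eigenvalues positive, as the scalar lemmas require.
  have hcases : ∀ j k, (inner ℂ (f k) (e j) : ℂ) = 0 ∨ l j = 0 ∨ 0 < l j ∧ 0 < s k := by
    intro j k
    rcases (hl j).eq_or_lt with hj | hj
    · exact Or.inr (Or.inl hj.symm)
    rcases (hs k).eq_or_lt with hk | hk
    · exact (h0 j k hk.symm).symm.imp_right Or.inl
    · exact Or.inr (Or.inr ⟨hj, hk⟩)
  refine ⟨⟨⟨_, (PetzRenyi.isLeast_range_objEnd he hf hs h0).2⟩, fun r hr =>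
    ⟨⟨_, (PetzRenyi.isLeast_range_objFirst he hf hl hs hr.le).2⟩,
      ⟨_, (PetzRenyi.isLeast_range_objSecond he hf hl hs hr.le).2⟩⟩⟩,
    fun m hm => ⟨PetzRenyi.exists_isGaussRadauJacobi hβ hm,
      PetzRenyi.exists_isGaussRadauJacobi hβ' hm⟩,
    fun m t w t' w' h h' => ⟨fun i hi => ?_, ?_⟩, fun t w t' w' h h' => ?_⟩
  · have hi := Finset.mem_Icc.2 hi
    exact ⟨h.node_mem_Ico hβ hi, h'.node_mem_Ico hβ' hi, h.weight_pos hβ hi, h'.weight_pos hβ' hi⟩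
  · rw [PetzRenyi.petzTrace_eq_sum hρ hσ he hf,
      PetzRenyi.upperBound_eq_sum he hf hl hs h0 hα h h']
    refine Finset.sum_le_sum fun j _ => Finset.sum_le_sum fun k _ => ?_
    rcases hcases j k with hc | hj | ⟨hj, hk⟩
    · simp [hc]
    · simp [hj, PetzRenyi.scalarBound_zero_left, Real.zero_rpow hα0]
    · exact mul_le_mul_of_nonneg_right (PetzRenyi.rpow_mul_rpow_le_scalarBound hα h h' hj hk)
        (sq_nonneg _)
  · rw [PetzRenyi.petzTrace_eq_sum hρ hσ he hf]
    refine Tendsto.congr' (f₁ := fun m => ∑ j, ∑ k,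
      Real.sin ((α - 1) * Real.pi) / Real.pi *
        PetzRenyi.scalarBound α m (t m) (w m) (t' m) (w' m) (l j) (s k) *
          ‖inner ℂ (f k) (e j)‖ ^ 2) ?_ ?_
    · filter_upwards [eventually_ge_atTop 1] with m hm
      rw [PetzRenyi.upperBound_eq_sum he hf hl hs h0 hα (h m hm) (h' m hm)]
    · refine tendsto_finsetSum _ fun j _ => tendsto_finsetSum _ fun k _ => ?_
      rcases hcases j k with hc | hj | ⟨hj, hk⟩
      · simp [hc]
      · simp [hj, PetzRenyi.scalarBound_zero_left, Real.zero_rpow hα0]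
      · exact (PetzRenyi.tendsto_scalarBound hα h h' hj hk).mul_const _
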